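/- Let $1\le p<\infty$ and $\lambda\ge 1$. Then there is a constant $d>0$, depending only on $p$ and $\lambda$, such that for every nonzero complex Banach space $X$, every $1\le q\le\infty$ and every integer $n>1$, $$\frac{r^n_p(B_{\ell_q^n},X,1)}{n^{1/q}}\ \le\ A_p(B_{\ell_q^n},X,\lambda)\ \le\ d\,\frac{(\log n)^{1-1/\min\{q,2\}}}{n^{\frac1p+\frac1{\max\{2,q\}}-\frac12}},$$ where $1/\infty=0$. Here $B_{\ell_q^n}=\{z\in\mathbb C^n:\|z\|_q<1\}$ is the open unit ball of $\ell_q^n$. A holomorphic map $f:\Omega\to X$ on $\Omega=B_{\ell_q^n}$ is written through its monomial expansion $f(z)=\sum_{\alpha\in\mathbb N_0^n}x_\alpha(f)z^\alpha$, and $\|f\|_\Omega=\sup_{z\in\Omega}\|f(z)\|\in[0,\infty]$. The Bohr radius $r^n_p(\Omega,X,\lambda)$ is the supremum of all $r\in[0,1]$ such that $$\sup_{z\in r\Omega}\sum_{\alpha\in\mathbb N_0^n}\|x_\alpha(f)z^\alpha\|^p\le\lambda\|f\|_\Omega^p$$ for all holomorphic $f:\Omega\to X$, and the arithmetic Bohr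 radius $A_p(\Omega,X,\lambda)$ is the supremum of the means $\frac1n\sum_{i=1}^n r_i$ over all $r=(r_1,\dots,r_n)$ with $r_i\ge 0$ such that $$\sum_{\alpha\in\mathbb N_0^n}\|x_\alpha(f)\|^p r^{p\alpha}\le\lambda\|f\|_\Omega^p$$ for all bounded holomorphic $f:\Omega\to X$. -/

import Mathlib

open scoped NNReal ENNReal Pointwise

noncomputable section

namespace Bohr

variable {n : ℕ} {X : Type*} [NormedAddCommGroup X] [NormedSpace ℂ X]

/-- The open unit ball of `ℓ_q^n`, as a subset of `ℂ^n`, where `1 ≤ q ≤ ∞`. -/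
def lqBall (n : ℕ) (q : ℝ≥0∞) : Set (Fin n → ℂ) :=
  {z | ‖(WithLp.toLp q z : PiLp q fun _ : Fin n => ℂ)‖ < 1}

/-- The family `x` is the family of coefficients of the monomial expansion
`f(z) = ∑_α x_α z^α` on `Ω`. A holomorphic map on a complete Reinhardt domain has exactly one such
family, and its expansion converges absolutely at each point of the domain. -/
def IsMonomialExpansion (Ω : Set (Fin n → ℂ)) (f : (Fin n → ℂ) → X) (x : (Fin n → ℕ) → X) : Prop :=
  ∀ z ∈ Ω, HasSum (fun α : Fin n → ℕ => (∏ i, z i ^ α i) • x α) (f z)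

/-- `‖f‖_Ω = sup {‖f(z)‖ : z ∈ Ω}`, with value `∞` if `f` is unbounded on `Ω`. -/
def supNorm (Ω : Set (Fin n → ℂ)) (f : (Fin n → ℂ) → X) : ℝ≥0∞ :=
  ⨆ z ∈ Ω, ‖f z‖ₑ

variable (X) in
/-- The holomorphic maps on `Ω` with values in `X` (values outside `Ω` play no role). -/
def holomorphicMaps (Ω : Set (Fin n → ℂ)) : Set ((Fin n → ℂ) → X) :=
  {f | DifferentiableOn ℂ f Ω}

variable (X) in
/-- The bounded holomorphic maps on `Ω` with values in `X`. -/
def boundedHolomorphicMaps (Ω : Set (Fin n → ℂ)) : Set ((Fin n → ℂ) → X) :=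
  {f | DifferentiableOn ℂ f Ω ∧ ∃ C : ℝ, ∀ z ∈ Ω, ‖f z‖ ≤ C}

variable (X) in
/-- The Bohr radius `r^n_p(Ω, X, lam)`: the supremum of all `r ∈ [0, 1]` such that
`sup_{z ∈ rΩ} ∑_α ‖x_α(f) z^α‖^p ≤ lam ‖f‖_Ω^p` for all holomorphic `f : Ω → X`. -/
def bohrRadius (p : ℝ) (Ω : Set (Fin n → ℂ)) (lam : ℝ) : ℝ≥0∞ :=
  sSup {a : ℝ≥0∞ | ∃ r : ℝ≥0, r ≤ 1 ∧ a = r ∧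
    ∀ f ∈ holomorphicMaps X Ω, ∀ x : (Fin n → ℕ) → X, IsMonomialExpansion Ω f x →
      (⨆ z ∈ ((r : ℝ) : ℂ) • Ω, ∑' α : Fin n → ℕ, ‖(∏ i, z i ^ α i) • x α‖ₑ ^ p)
        ≤ ENNReal.ofReal lam * supNorm Ω f ^ p}

/-- The arithmetic Bohr radius `A_p(F, lam)` of `Ω` with respect to a class `F` of holomorphic maps
on `Ω`: the supremum in `[0, ∞]` of the means `(r_1 + ⋯ + r_n) / n` over all `r` with nonnegative
entries such that `∑_α ‖x_α(f)‖^p r^{pα} ≤ lam ‖f‖_Ω^p` for all `f ∈ F`. -/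
def arithmeticBohrRadiusOf (p : ℝ) (Ω : Set (Fin n → ℂ)) (F : Set ((Fin n → ℂ) → X)) (lam : ℝ) :
    ℝ≥0∞ :=
  sSup {a : ℝ≥0∞ | ∃ r : Fin n → ℝ≥0, a = ((1 / n * ∑ i, r i : ℝ≥0) : ℝ≥0∞) ∧
    ∀ f ∈ F, ∀ x : (Fin n → ℕ) → X, IsMonomialExpansion Ω f x →
      ∑' α : Fin n → ℕ, ‖x α‖ₑ ^ p * ((∏ i, r i ^ α i : ℝ≥0) : ℝ≥0∞) ^ p
        ≤ ENNReal.ofReal lam * supNorm Ω f ^ p}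

variable (X) in
/-- `A_p(Ω, X, lam)`, the arithmetic Bohr radius for bounded holomorphic maps `Ω → X`. -/
def arithmeticBohrRadius (p : ℝ) (Ω : Set (Fin n → ℂ)) (lam : ℝ) : ℝ≥0∞ :=
  arithmeticBohrRadiusOf p Ω (boundedHolomorphicMaps X Ω) lam

end Bohr

end

/-! Lower bound: if `r` is admissible for the Bohr radius and `t < r`, the constant vector with
entries `t / n^{1/q}` lies in `rΩ`, so it is admissible for the arithmetic radius. Upper bound: test
an admissible `r` on `P = ∑ ε_α (m!/α!) z^α`, `|α| = m`, times a unit vector of `X`. Since `p ≥ 1`,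
`(m!/α!)^p ≥ m!/α!`, so the multinomial theorem gives `(∑ r_i^p)^m ≤ λ ‖P‖_Ω^p`. It remains to
choose unimodular `ε` with `‖P‖_Ω` small. On the Euclidean ball, `|P|^{2n}` is at most the squared
Bombieri norm of `P^n`, which does not depend on `z`. Averaging that norm over `ε` therefore gives
one `ε` good for all `z` (`exists_unimodular_norm_sq_le`), with no covering argument. For `q ≤ 2`,
interpolate with the trivial bound 1 on the `ℓ_1` ball (`norm_unimodularPolynomial_le_interp`); for
`q ≥ 2`, rescale to the Euclidean ball. Taking `m = ⌈log n⌉` makes the `m`-th root of the bound of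
order `log n`, and the power mean inequality passes from `∑ r_i^p` to the mean
(`mean_le_of_sum_rpow_pow_le`). -/

open Finset

/-! ### Averaging over roots of unity -/

section RandomSigns

variable {ι : Type*} [Fintype ι]

/-- Orthogonality of the characters `g ↦ ∏ i, ζ ^ (g i * ν i)` for `ν` with entries below the order
of the root of unity `ζ`. -/
lemma sum_prod_rootsOfUnity_mul_conj [DecidableEq ι] {N : ℕ} [NeZero N] {ζ : ℂ}
    (hζ : IsPrimitiveRoot ζ N) {ν μ : ι → ℕ} (hν : ∀ i, ν i < N) (hμ : ∀ i, μ i < N) :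
    ∑ g : ι → Fin N, (∏ i, (ζ ^ (g i : ℕ)) ^ ν i) * (starRingEnd ℂ) (∏ i, (ζ ^ (g i : ℕ)) ^ μ i)
      = if ν = μ then (N : ℂ) ^ Fintype.card ι else 0 := by
  have hnorm : ‖ζ‖ = 1 := hζ.norm'_eq_one (NeZero.ne N)
  have hconj : ζ * (starRingEnd ℂ) ζ = 1 := by
    rw [Complex.mul_conj, Complex.normSq_eq_norm_sq, hnorm]; norm_num
  have h0 : ∀ g : ι → Fin N,
      (∏ i, (ζ ^ (g i : ℕ)) ^ ν i) * (starRingEnd ℂ) (∏ i, (ζ ^ (g i : ℕ)) ^ μ i)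
        = ∏ i, (ζ ^ ν i * (starRingEnd ℂ) ζ ^ μ i) ^ (g i : ℕ) := by
    intro g
    rw [map_prod, ← Finset.prod_mul_distrib]
    refine Finset.prod_congr rfl fun i _ => ?_
    rw [map_pow, map_pow, mul_pow, ← pow_mul, ← pow_mul, ← pow_mul, ← pow_mul,
      mul_comm (g i : ℕ), mul_comm (g i : ℕ)]
  simp_rw [h0]
  rw [← Fintype.prod_sum (f := fun i (x : Fin N) => (ζ ^ ν i * (starRingEnd ℂ) ζ ^ μ i) ^ (x : ℕ))]
  split_ifs with h
  · subst h
    have : ∀ i, ζ ^ ν i * (starRingEnd ℂ) ζ ^ ν i = 1 := fun i => by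
      rw [← mul_pow, hconj, one_pow]
    simp [this]
  · obtain ⟨i, hi⟩ := Function.ne_iff.mp h
    refine Finset.prod_eq_zero (Finset.mem_univ i) ?_
    rw [Fin.sum_univ_eq_sum_range (fun x => (ζ ^ ν i * (starRingEnd ℂ) ζ ^ μ i) ^ x) N]
    set y := ζ ^ ν i * (starRingEnd ℂ) ζ ^ μ i with hy
    have hyN : y ^ N = 1 := by
      rw [hy, mul_pow, ← pow_mul, ← pow_mul, mul_comm _ N, mul_comm _ N, pow_mul, pow_mul,
        hζ.pow_eq_one, ← map_pow, hζ.pow_eq_one]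
      simp
    have hy1 : y ≠ 1 := by
      intro hy1
      apply hi
      apply hζ.pow_inj (hν i) (hμ i)
      calc ζ ^ ν i = ζ ^ ν i * (ζ * (starRingEnd ℂ) ζ) ^ μ i := by rw [hconj]; simp
        _ = y * ζ ^ μ i := by rw [hy, mul_pow]; ring
        _ = ζ ^ μ i := by rw [hy1, one_mul]
    have := mul_geom_sum y N
    rw [hyN, sub_self] at this
    exact (mul_eq_zero.mp this).resolve_left (sub_ne_zero.mpr hy1)

/-- Parseval's identity for polynomials in roots of unity. -/
lemma sum_normSq_polynomial_rootsOfUnity [DecidableEq ι] {N : ℕ} [NeZero N] {ζ : ℂ}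
    (hζ : IsPrimitiveRoot ζ N) (V : Finset (ι → ℕ)) (hV : ∀ ν ∈ V, ∀ i, ν i < N)
    (a : (ι → ℕ) → ℂ) :
    ∑ g : ι → Fin N, ‖∑ ν ∈ V, a ν * ∏ i, (ζ ^ (g i : ℕ)) ^ ν i‖ ^ 2
      = (N : ℝ) ^ Fintype.card ι * ∑ ν ∈ V, ‖a ν‖ ^ 2 := by
  have key : ∀ x : ℂ, ((‖x‖ ^ 2 : ℝ) : ℂ) = x * (starRingEnd ℂ) x := fun x => by
    rw [Complex.mul_conj, Complex.normSq_eq_norm_sq]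
  apply Complex.ofReal_injective
  rw [Complex.ofReal_sum, Complex.ofReal_mul, Complex.ofReal_sum]
  simp_rw [key, map_sum, map_mul, Finset.sum_mul_sum]
  rw [Finset.sum_comm, Finset.mul_sum]
  refine Finset.sum_congr rfl fun ν hν => ?_
  rw [Finset.sum_comm]
  have : ∀ μ ∈ V, ∑ g : ι → Fin N, a ν * (∏ i, (ζ ^ (g i : ℕ)) ^ ν i) *
      ((starRingEnd ℂ) (a μ) * (starRingEnd ℂ) (∏ i, (ζ ^ (g i : ℕ)) ^ μ i))
      = if ν = μ then (N : ℂ) ^ Fintype.card ι * (a ν * (starRingEnd ℂ) (a μ)) else 0 := by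
    intro μ hμ
    have h := sum_prod_rootsOfUnity_mul_conj hζ (hV ν hν) (hV μ hμ)
    calc _ = (a ν * (starRingEnd ℂ) (a μ)) * ∑ g : ι → Fin N, (∏ i, (ζ ^ (g i : ℕ)) ^ ν i) *
          (starRingEnd ℂ) (∏ i, (ζ ^ (g i : ℕ)) ^ μ i) := by
            rw [Finset.mul_sum]; exact Finset.sum_congr rfl fun g _ => by ring
      _ = _ := by rw [h]; split_ifs <;> ring
  rw [Finset.sum_congr rfl this, Finset.sum_ite_eq V ν, if_pos hν]
  push_cast
  rfl

/-- There are unimodular `ε i` for which a weighted sum of squares of polynomials in `ε` is at most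
its mean. -/
lemma exists_unimodular_sum_normSq_le {κ : Type*} (k : ℕ) (T : Finset κ)
    (V : κ → Finset (ι → ℕ)) (hV : ∀ β ∈ T, ∀ ν ∈ V β, ∀ i, ν i ≤ k) (w : κ → ℝ)
    (a : (ι → ℕ) → ℂ) :
    ∃ ε : ι → ℂ, (∀ i, ‖ε i‖ = 1) ∧
      ∑ β ∈ T, w β * ‖∑ ν ∈ V β, a ν * ∏ i, ε i ^ ν i‖ ^ 2
        ≤ ∑ β ∈ T, w β * ∑ ν ∈ V β, ‖a ν‖ ^ 2 := by
  classical
  -- Order `k + 1` keeps the characters with exponents `0, …, k` distinct, hence orthogonal.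
  have hζ := Complex.isPrimitiveRoot_exp (k + 1) (Nat.succ_ne_zero k)
  set ζ := Complex.exp (2 * Real.pi * Complex.I / ((k + 1 : ℕ) : ℂ))
  have hnorm : ‖ζ‖ = 1 := hζ.norm'_eq_one (Nat.succ_ne_zero k)
  obtain ⟨g, -, hg⟩ := Finset.exists_le_of_sum_le (s := (Finset.univ : Finset (ι → Fin (k + 1))))
    (f := fun g => ∑ β ∈ T, w β * ‖∑ ν ∈ V β, a ν * ∏ i, (ζ ^ (g i : ℕ)) ^ ν i‖ ^ 2)
    (g := fun _ => ∑ β ∈ T, w β * ∑ ν ∈ V β, ‖a ν‖ ^ 2) ⟨fun _ => 0, Finset.mem_univ _⟩ (by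
      rw [Finset.sum_comm]
      apply le_of_eq
      simp_rw [← Finset.mul_sum]
      rw [Finset.sum_const, Finset.card_univ, Fintype.card_fun, Fintype.card_fin, nsmul_eq_mul,
        Finset.mul_sum]
      refine Finset.sum_congr rfl fun β hβ => ?_
      rw [sum_normSq_polynomial_rootsOfUnity hζ (V β)
        (fun ν hν i => Nat.lt_succ_of_le (hV β hβ ν hν i)) a]
      push_cast
      ring)
  exact ⟨fun i => ζ ^ (g i : ℕ), fun i => by rw [norm_pow, hnorm, one_pow], hg⟩

end RandomSigns

/-! ### Powers of polynomials and the Bombieri norm -/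

section Bombieri

variable {ι : Type*} [Fintype ι] {n m k : ℕ}

/-- The multi-indices in `n` variables of total degree `m`. -/
abbrev multiIndices (n m : ℕ) : Finset (Fin n → ℕ) := Finset.piAntidiag Finset.univ m

/-- The exponent of the product of the monomials `z ^ e j`, the `j`-th one taken `ν j` times. -/
def totalExponent (e : ι → Fin n → ℕ) (ν : ι → ℕ) : Fin n → ℕ := fun i => ∑ j, ν j * e j i

/-- The ways of writing `β` as a sum of `k` of the multi-indices `e j`. -/
def powerFiber [DecidableEq ι] (e : ι → Fin n → ℕ) (k : ℕ) (β : Fin n → ℕ) : Finset (ι → ℕ) :=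
  {ν ∈ Finset.piAntidiag Finset.univ k | totalExponent e ν = β}

/-- The coefficient of `z ^ β` in the `k`-th power of the polynomial `∑ j, a j * z ^ e j`. -/
def powerCoeff {R : Type*} [CommSemiring R] [DecidableEq ι] (e : ι → Fin n → ℕ) (a : ι → R) (k : ℕ)
    (β : Fin n → ℕ) : R :=
  ∑ ν ∈ powerFiber e k β, (Nat.multinomial Finset.univ ν : R) * ∏ j, a j ^ ν j

lemma sum_monomial_pow {R : Type*} [CommSemiring R] [DecidableEq ι] (e : ι → Fin n → ℕ)
    (he : ∀ j, ∑ i, e j i = m) (a : ι → R) (z : Fin n → R) (k : ℕ) :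
    (∑ j, a j * ∏ i, z i ^ e j i) ^ k
      = ∑ β ∈ multiIndices n (m * k), powerCoeff e a k β * ∏ i, z i ^ β i := by
  rw [Finset.sum_pow_eq_sum_piAntidiag, ← Finset.sum_fiberwise_of_maps_to
    (t := multiIndices n (m * k)) (g := totalExponent e)]
  · refine Finset.sum_congr rfl fun β _ => ?_
    rw [powerCoeff, powerFiber, Finset.sum_mul]
    refine Finset.sum_congr rfl fun ν hν => ?_
    rw [← (Finset.mem_filter.mp hν).2, mul_assoc]
    congr 1
    have h : ∀ i, z i ^ totalExponent e ν i = ∏ j, (z i ^ e j i) ^ ν j := fun i => by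
      rw [totalExponent, ← Finset.prod_pow_eq_pow_sum]
      exact Finset.prod_congr rfl fun j _ => by rw [← pow_mul, mul_comm]
    simp_rw [h]
    rw [Finset.prod_comm, ← Finset.prod_mul_distrib]
    exact Finset.prod_congr rfl fun j _ => by rw [mul_pow, ← Finset.prod_pow]
  · intro ν hν
    rw [Finset.mem_piAntidiag] at hν ⊢
    refine ⟨?_, fun i _ => Finset.mem_univ i⟩
    change ∑ i, ∑ j, ν j * e j i = m * k
    rw [Finset.sum_comm]
    simp_rw [← Finset.mul_sum, he, ← Finset.sum_mul]
    rw [hν.1, mul_comm]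

lemma sum_multinomial_mul_prod {R : Type*} [CommSemiring R] (x : Fin n → R) (m : ℕ) :
    ∑ α ∈ multiIndices n m, (Nat.multinomial Finset.univ α : R) * ∏ i, x i ^ α i
      = (∑ i, x i) ^ m :=
  (Finset.sum_pow_eq_sum_piAntidiag Finset.univ x m).symm

lemma multinomial_pos' {κ : Type*} (s : Finset κ) (β : κ → ℕ) :
    (0 : ℝ) < Nat.multinomial s β := by
  exact_mod_cast Nat.multinomial_pos s β

/-- On the Euclidean unit ball, a power of a homogeneous polynomial is bounded by its Bombieri
norm. -/
lemma norm_pow_le_sum_powerCoeff [DecidableEq ι] (e : ι → Fin n → ℕ) (he : ∀ j, ∑ i, e j i = m)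
    (a : ι → ℂ) (z : Fin n → ℂ) (hz : ∑ i, ‖z i‖ ^ 2 ≤ 1) (k : ℕ) :
    (‖∑ j, a j * ∏ i, z i ^ e j i‖ ^ 2) ^ k
      ≤ ∑ β ∈ multiIndices n (m * k), (Nat.multinomial Finset.univ β : ℝ)⁻¹ *
          ‖powerCoeff e a k β‖ ^ 2 := by
  rw [← pow_mul, mul_comm 2 k, pow_mul, ← norm_pow, sum_monomial_pow e he]
  have h1 : ‖∑ β ∈ multiIndices n (m * k), powerCoeff e a k β * ∏ i, z i ^ β i‖
      ≤ ∑ β ∈ multiIndices n (m * k), ‖powerCoeff e a k β‖ * ∏ i, ‖z i‖ ^ β i := by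
    refine (norm_sum_le _ _).trans (le_of_eq (Finset.sum_congr rfl fun β _ => ?_))
    rw [norm_mul, norm_prod]
    simp_rw [norm_pow]
  -- Cauchy–Schwarz with multinomial weights, so that the second factor is `(∑ |z_i|²)^{mk}`.
  have h2 := Finset.sum_sq_le_sum_mul_sum_of_sq_le_mul (multiIndices n (m * k))
    (r := fun β => ‖powerCoeff e a k β‖ * ∏ i, ‖z i‖ ^ β i)
    (f := fun β => (Nat.multinomial Finset.univ β : ℝ)⁻¹ * ‖powerCoeff e a k β‖ ^ 2)
    (g := fun β => (Nat.multinomial Finset.univ β : ℝ) * ∏ i, (‖z i‖ ^ 2) ^ β i)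
    (fun β _ => by positivity) (fun β _ => by positivity) (fun β _ => by
      have := (multinomial_pos' Finset.univ β).ne'
      apply le_of_eq
      rw [mul_pow, ← Finset.prod_pow]
      simp_rw [← pow_mul, mul_comm 2]
      field_simp)
  rw [sum_multinomial_mul_prod (fun i => ‖z i‖ ^ 2)] at h2
  calc _ ≤ (∑ β ∈ multiIndices n (m * k), ‖powerCoeff e a k β‖ * ∏ i, ‖z i‖ ^ β i) ^ 2 := by
        gcongr
    _ ≤ _ := h2
    _ ≤ _ := by
      refine mul_le_of_le_one_right (Finset.sum_nonneg fun β _ => by positivity) ?_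
      exact pow_le_one₀ (by positivity) hz

end Bombieri

/-! ### A random polynomial that is small on the Euclidean ball -/

section KahaneSalemZygmund

variable {n m k : ℕ}

lemma multinomial_le_factorial {κ : Type*} {s : Finset κ} {β : κ → ℕ} {m : ℕ}
    (h : ∑ i ∈ s, β i = m) : Nat.multinomial s β ≤ m.factorial := by
  rw [Nat.multinomial, h]
  exact Nat.div_le_self _ _

lemma sum_val_multiIndices (j : multiIndices n m) : ∑ i, (j : Fin n → ℕ) i = m :=
  (Finset.mem_piAntidiag.mp j.2).1

/-- The coefficients of the `k`-th power of `(∑ i, t i) ^ m`. -/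
lemma powerCoeff_multinomial_le (n m k : ℕ) {β : Fin n → ℕ} (hβ : β ∈ multiIndices n (m * k)) :
    powerCoeff (fun j : multiIndices n m => (j : Fin n → ℕ))
        (fun j => (Nat.multinomial Finset.univ (j : Fin n → ℕ) : ℝ)) k β
      ≤ Real.exp (m * k : ℕ) * Nat.multinomial Finset.univ β := by
  set M := m * k
  set K := powerCoeff (fun j : multiIndices n m => (j : Fin n → ℕ))
        (fun j => (Nat.multinomial Finset.univ (j : Fin n → ℕ) : ℝ)) k
  have hK0 : ∀ β, 0 ≤ K β := fun β => Finset.sum_nonneg fun ν _ => by positivity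
  have hsum : ∑ i, β i = M := (Finset.mem_piAntidiag.mp hβ).1
  have hsum' : ∑ i, (β i : ℝ) = M := by exact_mod_cast hsum
  have h1 := sum_monomial_pow (fun j : multiIndices n m => (j : Fin n → ℕ)) sum_val_multiIndices
    (fun j => (Nat.multinomial Finset.univ (j : Fin n → ℕ) : ℝ)) (fun i => (β i : ℝ)) k
  have h2 := sum_multinomial_mul_prod (fun i => (β i : ℝ)) m
  rw [← Finset.sum_coe_sort] at h2
  rw [h2, ← pow_mul] at h1
  -- All coefficients are nonnegative, so a single term is at most the whole sum; the point `t = β`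
  -- makes this efficient, and `M^M ≤ e^M M!` then costs only the factor `e^M`.
  have h3 : K β * ∏ i, (β i : ℝ) ^ β i ≤ (M : ℝ) ^ M := by
    calc _ ≤ ∑ γ ∈ multiIndices n M, K γ * ∏ i, (β i : ℝ) ^ γ i :=
          Finset.single_le_sum (f := fun γ => K γ * ∏ i, (β i : ℝ) ^ γ i)
            (fun γ _ => mul_nonneg (hK0 γ) (by positivity)) hβ
      _ = _ := by rw [← h1, hsum']
  have h4 : (∏ i, ((β i).factorial : ℝ)) ≤ ∏ i, (β i : ℝ) ^ β i :=
    Finset.prod_le_prod (fun _ _ => by positivity) fun i _ => by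
      exact_mod_cast Nat.factorial_le_pow (β i)
  have h5 : (∏ i, ((β i).factorial : ℝ)) * Nat.multinomial Finset.univ β = M.factorial := by
    rw [← hsum]; exact_mod_cast Nat.multinomial_spec Finset.univ β
  have h6 : (M : ℝ) ^ M ≤ Real.exp M * M.factorial := by
    have := Real.pow_div_factorial_le_exp (x := (M : ℝ)) (by positivity) M
    rwa [div_le_iff₀ (by positivity)] at this
  have hpos : 0 < ∏ i, ((β i).factorial : ℝ) := by positivity
  refine le_of_mul_le_mul_right ?_ hpos
  calc K β * ∏ i, ((β i).factorial : ℝ) ≤ K β * ∏ i, (β i : ℝ) ^ β i :=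
        mul_le_mul_of_nonneg_left h4 (hK0 β)
    _ ≤ _ := h3.trans h6
    _ = _ := by rw [← h5]; ring

/-- Each multi-index of degree `M` has weight `∏ 2^{-β_i} = 2^{-M}`, while the weights over a whole
box sum to at most `2^n`, a product of geometric series. -/
lemma card_multiIndices_le (n M : ℕ) : (multiIndices n M).card ≤ 2 ^ (n + M) := by
  have h : ∑ β ∈ multiIndices n M, (∏ i, (2⁻¹ : ℝ) ^ β i) ≤ 2 ^ n := by
    calc _ ≤ ∑ β ∈ Fintype.piFinset (fun _ : Fin n => Finset.range (M + 1)),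
          (∏ i, (2⁻¹ : ℝ) ^ β i) := by
          refine Finset.sum_le_sum_of_subset_of_nonneg (fun β hβ => ?_) fun _ _ _ => by positivity
          rw [Fintype.mem_piFinset]
          intro i
          rw [Finset.mem_range, Nat.lt_succ_iff, ← (Finset.mem_piAntidiag.mp hβ).1]
          exact Finset.single_le_sum (fun _ _ => Nat.zero_le _) (Finset.mem_univ i)
      _ = ∏ _i : Fin n, ∑ b ∈ Finset.range (M + 1), (2⁻¹ : ℝ) ^ b :=
          (Finset.prod_univ_sum _ _).symm
      _ ≤ ∏ _i : Fin n, 2 := by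
          refine Finset.prod_le_prod (fun _ _ => by positivity) fun i _ => ?_
          have := Summable.sum_le_tsum (Finset.range (M + 1)) (fun b _ => by positivity)
            (summable_geometric_of_lt_one (r := (2⁻¹ : ℝ)) (by norm_num) (by norm_num))
          rw [tsum_geometric_of_lt_one (by norm_num) (by norm_num)] at this
          norm_num at this ⊢
          exact this
      _ = 2 ^ n := by simp
  have h' : ∀ β ∈ multiIndices n M, (∏ i, (2⁻¹ : ℝ) ^ β i) = (2 ^ M)⁻¹ := fun β hβ => by
    rw [Finset.prod_pow_eq_pow_sum, (Finset.mem_piAntidiag.mp hβ).1, inv_pow]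
  rw [Finset.sum_congr rfl h', Finset.sum_const, nsmul_eq_mul, ← div_eq_mul_inv,
    div_le_iff₀ (by positivity), ← pow_add] at h
  exact_mod_cast h

/-- One factor of each square is bounded by `k! W^k`; the other is kept and sums to a coefficient of
the power with all signs equal to 1. -/
lemma sum_norm_sq_le_mul_powerCoeff {ι : Type*} [Fintype ι] [DecidableEq ι] (e : ι → Fin n → ℕ)
    (w : ι → ℕ) {W : ℕ} (hw : ∀ j, w j ≤ W) (k : ℕ) (β : Fin n → ℕ) :
    ∑ ν ∈ powerFiber e k β, ‖(Nat.multinomial Finset.univ ν : ℂ) * ∏ j, (w j : ℂ) ^ ν j‖ ^ 2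
      ≤ ((k : ℝ) ^ k * (W : ℝ) ^ k) * powerCoeff e (fun j => (w j : ℝ)) k β := by
  rw [powerCoeff, Finset.mul_sum]
  refine Finset.sum_le_sum fun ν hν => ?_
  have hk : ∑ j, ν j = k := (Finset.mem_piAntidiag.mp (Finset.mem_filter.mp hν).1).1
  have hn1 : ‖(Nat.multinomial Finset.univ ν : ℂ) * ∏ j, (w j : ℂ) ^ ν j‖
      = (Nat.multinomial Finset.univ ν : ℝ) * ∏ j, (w j : ℝ) ^ ν j := by
    rw [norm_mul, norm_prod]
    simp
  rw [hn1, sq]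
  refine mul_le_mul_of_nonneg_right ?_ (by positivity)
  refine mul_le_mul ?_ ?_ (by positivity) (by positivity)
  · exact_mod_cast (multinomial_le_factorial hk).trans (Nat.factorial_le_pow k)
  · calc ∏ j, (w j : ℝ) ^ ν j ≤ ∏ j, (W : ℝ) ^ ν j := by
          refine Finset.prod_le_prod (fun _ _ => by positivity) fun j _ => ?_
          gcongr
          exact hw j
      _ = _ := by rw [Finset.prod_pow_eq_pow_sum, hk]

/-- There are unimodular coefficients `ε` for which the polynomial `∑ ε_α (m! / α!) z ^ α` is small
on the Euclidean unit ball, of order `√(n m!)` up to exponential factors in `m`. -/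
theorem exists_unimodular_norm_sq_le (n m : ℕ) (hn : 0 < n) :
    ∃ ε : multiIndices n m → ℂ, (∀ α, ‖ε α‖ = 1) ∧ ∀ z : Fin n → ℂ, ∑ i, ‖z i‖ ^ 2 ≤ 1 →
      ‖∑ α : multiIndices n m, (ε α * Nat.multinomial Finset.univ (α : Fin n → ℕ)) *
          ∏ i, z i ^ (α : Fin n → ℕ) i‖ ^ 2
        ≤ 2 * n * m.factorial * (2 * Real.exp 1) ^ m := by
  set e : multiIndices n m → Fin n → ℕ := fun j => (j : Fin n → ℕ) with he
  set w : multiIndices n m → ℕ := fun j => Nat.multinomial Finset.univ (j : Fin n → ℕ) with hw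
  have hfib : ∀ β, ∀ ν ∈ powerFiber e n β, ∑ j, ν j = n := fun β ν hν =>
    (Finset.mem_piAntidiag.mp (Finset.mem_filter.mp hν).1).1
  -- The power is taken equal to `n`: after the `n`-th root, the number `2^{n+mn}` of monomials
  -- costs only `2 · 2^m`, and `n! ≤ n^n` only `n`.
  obtain ⟨ε, hε, h⟩ := exists_unimodular_sum_normSq_le n (multiIndices n (m * n))
    (powerFiber e n) (fun β _ ν hν i => (Finset.single_le_sum (fun _ _ => Nat.zero_le _)
      (Finset.mem_univ i)).trans (hfib β ν hν).le)
    (fun β => (Nat.multinomial Finset.univ β : ℝ)⁻¹)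
    (fun ν => (Nat.multinomial Finset.univ ν : ℂ) * ∏ j, (w j : ℂ) ^ ν j)
  refine ⟨ε, hε, fun z hz => ?_⟩
  have hpc : ∀ β, powerCoeff e (fun j => ε j * (w j : ℂ)) n β
      = ∑ ν ∈ powerFiber e n β, ((Nat.multinomial Finset.univ ν : ℂ) * ∏ j, (w j : ℂ) ^ ν j) *
          ∏ j, ε j ^ ν j := fun β => by
    refine Finset.sum_congr rfl fun ν _ => ?_
    simp_rw [mul_pow, Finset.prod_mul_distrib]
    ring
  have h1 := norm_pow_le_sum_powerCoeff e sum_val_multiIndices (fun j => ε j * (w j : ℂ)) z hz n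
  simp_rw [hpc] at h1
  have h2 := h1.trans h
  have hterm : ∀ β ∈ multiIndices n (m * n), (Nat.multinomial Finset.univ β : ℝ)⁻¹ *
      ∑ ν ∈ powerFiber e n β, ‖(Nat.multinomial Finset.univ ν : ℂ) * ∏ j, (w j : ℂ) ^ ν j‖ ^ 2
      ≤ (n : ℝ) ^ n * (m.factorial : ℝ) ^ n * Real.exp (m * n : ℕ) := by
    intro β hβ
    have hb := powerCoeff_multinomial_le n m n hβ
    have hpos := multinomial_pos' Finset.univ β
    rw [inv_mul_le_iff₀ hpos]
    calc _ ≤ ((n : ℝ) ^ n * (m.factorial : ℝ) ^ n) * powerCoeff e (fun j => (w j : ℝ)) n β :=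
          sum_norm_sq_le_mul_powerCoeff e w
            (fun j => multinomial_le_factorial (sum_val_multiIndices j)) n β
      _ ≤ ((n : ℝ) ^ n * (m.factorial : ℝ) ^ n) *
          (Real.exp (m * n : ℕ) * Nat.multinomial Finset.univ β) := by gcongr
      _ = _ := by ring
  have h3 := h2.trans (Finset.sum_le_sum hterm)
  rw [Finset.sum_const, nsmul_eq_mul] at h3
  have hcard : ((multiIndices n (m * n)).card : ℝ) ≤ 2 ^ (n + m * n) := by
    exact_mod_cast card_multiIndices_le n (m * n)
  refine le_of_pow_le_pow_left₀ hn.ne' (by positivity) (h3.trans ?_)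
  calc _ ≤ (2 : ℝ) ^ (n + m * n) *
        ((n : ℝ) ^ n * (m.factorial : ℝ) ^ n * Real.exp (m * n : ℕ)) := by gcongr
    _ = _ := by
      have : Real.exp (m * n : ℕ) = (Real.exp 1 ^ m) ^ n := by
        rw [← pow_mul, ← Real.exp_nat_mul, mul_one]
      rw [this, pow_add, pow_mul]
      simp only [mul_pow]
      ring

end KahaneSalemZygmund

/-! ### Interpolation between `ℓ_1` and `ℓ_2` -/

section UnimodularPolynomial

variable {n m : ℕ}

/-- The homogeneous polynomial `∑ ε_α (m! / α!) z ^ α` of degree `m`. -/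
def unimodularPolynomial (ε : (Fin n → ℕ) → ℂ) (m : ℕ) (z : Fin n → ℂ) : ℂ :=
  ∑ α ∈ multiIndices n m, (ε α * Nat.multinomial Finset.univ α) * ∏ i, z i ^ α i

/-- The square of the bound on the Euclidean unit ball. -/
noncomputable def euclideanBound (n m : ℕ) : ℝ := 2 * n * m.factorial * (2 * Real.exp 1) ^ m

lemma euclideanBound_nonneg (n m : ℕ) : 0 ≤ euclideanBound n m := by
  unfold euclideanBound; positivity

lemma exists_unimodularPolynomial_norm_sq_le (n m : ℕ) (hn : 0 < n) :
    ∃ ε : (Fin n → ℕ) → ℂ, (∀ α, ‖ε α‖ = 1) ∧ ∀ z : Fin n → ℂ, ∑ i, ‖z i‖ ^ 2 ≤ 1 →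
      ‖unimodularPolynomial ε m z‖ ^ 2 ≤ euclideanBound n m := by
  classical
  obtain ⟨ε, hε, h⟩ := exists_unimodular_norm_sq_le n m hn
  refine ⟨fun α => if hα : α ∈ multiIndices n m then ε ⟨α, hα⟩ else 1, fun α => ?_, fun z hz => ?_⟩
  · dsimp only
    split_ifs
    · exact hε _
    · exact norm_one
  · unfold euclideanBound
    convert h z hz using 3
    rw [unimodularPolynomial, ← Finset.sum_coe_sort]
    exact Finset.sum_congr rfl fun α _ => by rw [dif_pos α.2]

lemma differentiable_unimodularPolynomial (ε : (Fin n → ℕ) → ℂ) (m : ℕ) :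
    Differentiable ℂ (unimodularPolynomial ε m) := by
  unfold unimodularPolynomial
  fun_prop

/-- The `ℓ_1` endpoint of the interpolation; it also gives boundedness on the strip. -/
lemma norm_unimodularPolynomial_le_sum_pow {ε : (Fin n → ℕ) → ℂ} (hε : ∀ α, ‖ε α‖ = 1)
    (m : ℕ) (z : Fin n → ℂ) : ‖unimodularPolynomial ε m z‖ ≤ (∑ i, ‖z i‖) ^ m := by
  rw [← sum_multinomial_mul_prod]
  refine (norm_sum_le _ _).trans (le_of_eq (Finset.sum_congr rfl fun α _ => ?_))
  rw [norm_mul, norm_mul, hε, norm_prod]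
  simp

lemma unimodularPolynomial_smul (ε : (Fin n → ℕ) → ℂ) (m : ℕ) (c : ℂ) (z : Fin n → ℂ) :
    unimodularPolynomial ε m (fun i => c * z i) = c ^ m * unimodularPolynomial ε m z := by
  rw [unimodularPolynomial, unimodularPolynomial, Finset.mul_sum]
  refine Finset.sum_congr rfl fun α hα => ?_
  simp_rw [mul_pow, Finset.prod_mul_distrib]
  rw [Finset.prod_pow_eq_pow_sum, (Finset.mem_piAntidiag.mp hα).1]
  ring

lemma norm_sq_unimodularPolynomial_le_mul_pow {ε : (Fin n → ℕ) → ℂ} {C S : ℝ}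
    (h : ∀ z : Fin n → ℂ, ∑ i, ‖z i‖ ^ 2 ≤ 1 → ‖unimodularPolynomial ε m z‖ ^ 2 ≤ C)
    (hS : 0 < S) {z : Fin n → ℂ} (hz : ∑ i, ‖z i‖ ^ 2 ≤ S) :
    ‖unimodularPolynomial ε m z‖ ^ 2 ≤ C * S ^ m := by
  have hs : 0 < √S := Real.sqrt_pos.mpr hS
  have hsq : √S ^ 2 = S := Real.sq_sqrt hS.le
  have h1 := h (fun i => ((√S)⁻¹ : ℝ) * z i) (by
    simp_rw [norm_mul, mul_pow, ← Finset.mul_sum]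
    rw [Complex.norm_real, Real.norm_eq_abs, sq_abs, inv_pow, hsq, inv_mul_le_iff₀ hS, mul_one]
    exact hz)
  rw [unimodularPolynomial_smul, norm_mul, norm_pow, Complex.norm_real, Real.norm_eq_abs, mul_pow,
    ← pow_mul, mul_comm m 2, pow_mul, sq_abs, inv_pow, hsq, inv_pow,
    inv_mul_le_iff₀ (by positivity)] at h1
  linarith

/-- Interpolation between the bounds on the unit balls of `ℓ_1` and `ℓ_2`. -/
lemma norm_unimodularPolynomial_le_interp {ε : (Fin n → ℕ) → ℂ} (hε : ∀ α, ‖ε α‖ = 1) {C : ℝ}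
    (hC : 0 ≤ C)
    (h : ∀ z : Fin n → ℂ, ∑ i, ‖z i‖ ^ 2 ≤ 1 → ‖unimodularPolynomial ε m z‖ ^ 2 ≤ C)
    {q : ℝ} (hq1 : 1 ≤ q) (hq2 : q ≤ 2) {z : Fin n → ℂ} (hz : ∑ i, ‖z i‖ ^ q ≤ 1) :
    ‖unimodularPolynomial ε m z‖ ≤ C ^ (1 - 1 / q) := by
  have hq0 : 0 < q := by linarith
  have hzi : ∀ i, ‖z i‖ ≤ 1 := fun i => by
    have : ‖z i‖ ^ q ≤ 1 := (Finset.single_le_sum (f := fun i => ‖z i‖ ^ q)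
      (fun _ _ => by positivity) (Finset.mem_univ i)).trans hz
    by_contra hlt
    exact absurd this (not_le.mpr (Real.one_lt_rpow (not_le.mp hlt) hq0))
  -- An analytic family with `|w_i| = |z_i|^{q(1 - Re s/2)}` for `z_i ≠ 0`: it lies in the `ℓ_1`
  -- ball for `Re s = 0`, in the `ℓ_2` ball for `Re s = 1`, and equals `z` at `s = 2 - 2/q`. If `z_i
  -- = 0`, the convention `0 / 0 = 0` gives `w_i = 0`.
  set w : ℂ → Fin n → ℂ := fun s i =>
    (z i / ‖z i‖) * Complex.exp (q * (1 - s / 2) * Real.log ‖z i‖) with hw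
  have hwn : ∀ s i, ‖w s i‖ = if z i = 0 then 0 else ‖z i‖ ^ (q * (1 - s.re / 2)) := by
    intro s i
    split_ifs with h0
    · simp [hw, h0]
    · have hpos : 0 < ‖z i‖ := norm_pos_iff.mpr h0
      rw [hw]
      dsimp only
      rw [norm_mul, norm_div, Complex.norm_real, norm_norm, div_self hpos.ne', one_mul,
        Complex.norm_exp, Real.rpow_def_of_pos hpos]
      congr 1
      simp
      ring
  have hw1 : ∀ s : ℂ, s.re ≤ 1 → ∀ i, ‖w s i‖ ≤ 1 := by
    intro s hs i
    rw [hwn]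
    split_ifs with h0
    · exact zero_le_one
    · exact Real.rpow_le_one (norm_nonneg _) (hzi i) (mul_nonneg hq0.le (by linarith))
  have hwd : Differentiable ℂ w := by
    rw [differentiable_pi]
    intro i
    simp only [hw]
    fun_prop
  have hd : Differentiable ℂ (fun s => unimodularPolynomial ε m (w s)) :=
    (differentiable_unimodularPolynomial ε m).comp hwd
  have hθ : 0 ≤ 2 - 2 / q ∧ 2 - 2 / q ≤ 1 := by
    constructor
    · have : 2 / q ≤ 2 := by rw [div_le_iff₀ hq0]; linarith
      linarith
    · have : 1 ≤ 2 / q := by rw [le_div_iff₀ hq0]; linarith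
      linarith
  have key := Complex.HadamardThreeLines.norm_le_interp_of_mem_verticalClosedStrip'
    (f := fun s => unimodularPolynomial ε m (w s)) (z := ((2 - 2 / q : ℝ) : ℂ)) (a := 1)
    (b := √C) (l := 0) (u := 1) zero_lt_one
    (by
      rw [Complex.HadamardThreeLines.verticalClosedStrip, Set.mem_preimage, Complex.ofReal_re]
      exact ⟨hθ.1, hθ.2⟩) hd.diffContOnCl
    (by
      refine ⟨(n : ℝ) ^ m, ?_⟩
      rintro _ ⟨s, hs, rfl⟩
      refine (norm_unimodularPolynomial_le_sum_pow hε m _).trans ?_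
      refine pow_le_pow_left₀ (by positivity) ?_ m
      refine (Finset.sum_le_sum fun i _ => hw1 s hs.2 i).trans ?_
      simp)
    (by
      intro s hs
      rw [Set.mem_preimage, Set.mem_singleton_iff] at hs
      refine (norm_unimodularPolynomial_le_sum_pow hε m _).trans (pow_le_one₀ (by positivity) ?_)
      refine le_trans (Finset.sum_le_sum fun i _ => ?_) hz
      rw [hwn, hs]
      split_ifs
      · positivity
      · simp)
    (by
      intro s hs
      rw [Set.mem_preimage, Set.mem_singleton_iff] at hs
      apply Real.le_sqrt_of_sq_le
      apply h
      refine le_trans (Finset.sum_le_sum fun i _ => ?_) hz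
      rw [hwn, hs]
      split_ifs
      · rw [zero_pow two_ne_zero]; positivity
      · rw [← Real.rpow_natCast, ← Real.rpow_mul (norm_nonneg _)]
        apply le_of_eq
        congr 1
        push_cast
        ring)
  have hwz : w ((2 - 2 / q : ℝ) : ℂ) = z := by
    funext i
    by_cases h0 : z i = 0
    · simp [hw, h0]
    · have hpos : 0 < ‖z i‖ := norm_pos_iff.mpr h0
      have h1 : (q : ℂ) * (1 - ((2 - 2 / q : ℝ) : ℂ) / 2) = 1 := by
        have : (q : ℂ) ≠ 0 := by exact_mod_cast hq0.ne'
        push_cast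
        field_simp
        ring
      have h2 : ((‖z i‖ : ℝ) : ℂ) ≠ 0 := by exact_mod_cast hpos.ne'
      simp only [hw]
      rw [h1, one_mul, ← Complex.ofReal_exp, Real.exp_log hpos, div_mul_cancel₀ _ h2]
  simp only [hwz, Complex.ofReal_re, sub_zero, div_one, Real.one_rpow, one_mul] at key
  refine key.trans (le_of_eq ?_)
  rw [Real.sqrt_eq_rpow, ← Real.rpow_mul hC]
  congr 1
  field_simp

end UnimodularPolynomial

/-! ### Sup norms on the balls of `ℓ_q^n` -/

section LqBall

variable {n : ℕ}

lemma sum_rpow_lt_one_of_mem_lqBall {q : ℝ≥0∞} (hq0 : 0 < q.toReal) {z : Fin n → ℂ}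
    (hz : z ∈ Bohr.lqBall n q) : ∑ i, ‖z i‖ ^ q.toReal < 1 := by
  have h : ‖(WithLp.toLp q z : PiLp q fun _ : Fin n => ℂ)‖ < 1 := hz
  rw [PiLp.norm_eq_sum hq0] at h
  by_contra hge
  exact absurd h (not_lt.mpr (Real.one_le_rpow (not_lt.mp hge) (by positivity)))

lemma norm_lt_one_of_mem_lqBall_top {z : Fin n → ℂ} (hz : z ∈ Bohr.lqBall n ∞) (i : Fin n) :
    ‖z i‖ < 1 := by
  have h : ‖(WithLp.toLp ∞ z : PiLp ∞ fun _ : Fin n => ℂ)‖ < 1 := hz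
  exact (PiLp.norm_apply_le (WithLp.toLp ∞ z : PiLp ∞ fun _ : Fin n => ℂ) i).trans_lt h

lemma sum_sq_le_of_mem_lqBall (hn : 0 < n) {q : ℝ≥0∞} (hq : 2 ≤ q) {z : Fin n → ℂ}
    (hz : z ∈ Bohr.lqBall n q) : ∑ i, ‖z i‖ ^ 2 ≤ (n : ℝ) ^ (1 - 2 * (1 / q).toReal) := by
  rcases eq_or_ne q ∞ with rfl | hqt
  · calc ∑ i, ‖z i‖ ^ 2 ≤ ∑ _i : Fin n, (1 : ℝ) := Finset.sum_le_sum fun i _ =>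
          pow_le_one₀ (norm_nonneg _) (norm_lt_one_of_mem_lqBall_top hz i).le
      _ = _ := by simp
  · have ht : 2 ≤ q.toReal := by
      have := ENNReal.toReal_mono hqt hq
      simpa using this
    set t := q.toReal with htd
    have ht0 : 0 < t := by linarith
    have hn' : (0 : ℝ) < n := by exact_mod_cast hn
    have h1 := (sum_rpow_lt_one_of_mem_lqBall ht0 hz).le
    -- Hölder's inequality with exponent `q/2 ≥ 1`, applied to the squares.
    have h2 := Real.rpow_sum_le_const_mul_sum_rpow Finset.univ (fun i => ‖z i‖ ^ 2)
      (p := t / 2) (by linarith)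
    have h3 : ∀ i, |‖z i‖ ^ 2| ^ (t / 2) = ‖z i‖ ^ t := fun i => by
      rw [abs_of_nonneg (by positivity), ← Real.rpow_natCast, ← Real.rpow_mul (norm_nonneg _)]
      congr 1
      push_cast
      ring
    simp_rw [h3] at h2
    have h3' : ∀ i, |‖z i‖ ^ 2| = ‖z i‖ ^ 2 := fun i => abs_of_nonneg (by positivity)
    simp_rw [h3'] at h2
    rw [Finset.card_univ, Fintype.card_fin] at h2
    have h4 : (∑ i, ‖z i‖ ^ 2) ^ (t / 2) ≤ ((n : ℝ) ^ (1 - 2 * (1 / q).toReal)) ^ (t / 2) := by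
      refine h2.trans ((mul_le_of_le_one_right (by positivity) h1).trans (le_of_eq ?_))
      rw [← Real.rpow_mul hn'.le, ENNReal.toReal_div, ← htd]
      congr 1
      simp
      field_simp
    exact (Real.rpow_le_rpow_iff (by positivity) (by positivity) (by positivity)).mp h4

lemma exists_unimodularPolynomial_norm_le_on_lqBall (n m : ℕ) (hn : 0 < n) {q : ℝ≥0∞}
    (hq : 1 ≤ q) :
    ∃ ε : (Fin n → ℕ) → ℂ, (∀ α, ‖ε α‖ = 1) ∧ ∀ z ∈ Bohr.lqBall n q,
      ‖unimodularPolynomial ε m z‖ ≤ euclideanBound n m ^ (1 - (1 / min q 2).toReal) *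
        ((n : ℝ) ^ (1 / 2 - (1 / max 2 q).toReal)) ^ m := by
  obtain ⟨ε, hε, h⟩ := exists_unimodularPolynomial_norm_sq_le n m hn
  have hC := euclideanBound_nonneg n m
  refine ⟨ε, hε, fun z hz => ?_⟩
  rcases le_total q 2 with hq2 | hq2
  · have hqt : q ≠ ∞ := ne_top_of_le_ne_top ENNReal.ofNat_ne_top hq2
    have h1 : 1 ≤ q.toReal := by simpa using ENNReal.toReal_mono hqt hq
    have h2 : q.toReal ≤ 2 := by simpa using ENNReal.toReal_mono ENNReal.ofNat_ne_top hq2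
    rw [min_eq_left hq2, max_eq_left hq2]
    have := norm_unimodularPolynomial_le_interp hε hC h h1 h2
      (sum_rpow_lt_one_of_mem_lqBall (by linarith) hz).le
    simpa [ENNReal.toReal_div] using this
  · rw [min_eq_right hq2, max_eq_right hq2]
    have hn' : (0 : ℝ) < n := by exact_mod_cast hn
    have h1 := norm_sq_unimodularPolynomial_le_mul_pow h (by positivity)
      (sum_sq_le_of_mem_lqBall hn hq2 hz)
    have h2 : 1 - (1 / (2 : ℝ≥0∞)).toReal = 1 / 2 := by
      rw [ENNReal.toReal_div]; norm_num
    rw [h2, ← Real.sqrt_eq_rpow]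
    refine (Real.le_sqrt_of_sq_le h1).trans (le_of_eq ?_)
    rw [Real.sqrt_mul hC]
    congr 1
    rw [Real.sqrt_eq_iff_mul_self_eq (by positivity) (by positivity), ← mul_pow,
      ← Real.rpow_add hn']
    congr 2
    ring

end LqBall

/-! ### Bounds for the arithmetic Bohr radius -/

section ArithmeticBohrRadius

variable {n : ℕ} {X : Type*} [NormedAddCommGroup X] [NormedSpace ℂ X]

/-- Testing the inequality that defines the arithmetic Bohr radius on a unimodular polynomial. -/
lemma sum_rpow_pow_le_of_unimodularPolynomial_le [Nontrivial X] {p lam : ℝ} (hp : 1 ≤ p)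
    (hlam : 0 ≤ lam) {Ω : Set (Fin n → ℂ)} {r : Fin n → ℝ≥0}
    (hr : ∀ f ∈ Bohr.boundedHolomorphicMaps X Ω, ∀ x : (Fin n → ℕ) → X,
      Bohr.IsMonomialExpansion Ω f x →
        ∑' α : Fin n → ℕ, ‖x α‖ₑ ^ p * ((∏ i, r i ^ α i : ℝ≥0) : ℝ≥0∞) ^ p
          ≤ ENNReal.ofReal lam * Bohr.supNorm Ω f ^ p)
    {ε : (Fin n → ℕ) → ℂ} (hε : ∀ α, ‖ε α‖ = 1) {m : ℕ} {B : ℝ} (hB0 : 0 ≤ B)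
    (hB : ∀ z ∈ Ω, ‖unimodularPolynomial ε m z‖ ≤ B) :
    (∑ i, (r i : ℝ) ^ p) ^ m ≤ lam * B ^ p := by
  classical
  have hp0 : 0 ≤ p := by linarith
  obtain ⟨v, hv⟩ := exists_ne (0 : X)
  obtain ⟨e, he⟩ : ∃ e : X, ‖e‖ = 1 :=
    ⟨((‖v‖⁻¹ : ℝ) : ℂ) • v, by
      rw [norm_smul, Complex.norm_real, norm_inv, norm_norm,
        inv_mul_cancel₀ (norm_ne_zero_iff.mpr hv)]⟩
  set f : (Fin n → ℂ) → X := fun z => unimodularPolynomial ε m z • e with hf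
  set x : (Fin n → ℕ) → X := fun α =>
    if α ∈ multiIndices n m then (ε α * Nat.multinomial Finset.univ α) • e else 0 with hx
  have hfn : ∀ z, ‖f z‖ = ‖unimodularPolynomial ε m z‖ := fun z => by
    simp only [hf, norm_smul, he, mul_one]
  have hfmem : f ∈ Bohr.boundedHolomorphicMaps X Ω :=
    ⟨((differentiable_unimodularPolynomial ε m).smul_const e).differentiableOn, B,
      fun z hz => (hfn z).trans_le (hB z hz)⟩
  have hexp : Bohr.IsMonomialExpansion Ω f x := by
    intro z _
    have hfz : f z = ∑ α ∈ multiIndices n m, (∏ i, z i ^ α i) • x α := by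
      simp only [hf, unimodularPolynomial]
      rw [Finset.sum_smul]
      refine Finset.sum_congr rfl fun α hα => ?_
      simp only [hx]
      rw [if_pos hα, smul_smul, mul_comm]
    rw [hfz]
    refine hasSum_sum_of_ne_finset_zero fun α hα => ?_
    simp only [hx]
    rw [if_neg hα, smul_zero]
  have hsup : Bohr.supNorm Ω f ≤ ENNReal.ofReal B := by
    refine iSup₂_le fun z hz => ?_
    rw [← ofReal_norm, hfn]
    exact ENNReal.ofReal_le_ofReal (hB z hz)
  have h1 := hr f hfmem x hexp
  have h2 : ENNReal.ofReal ((∑ i, (r i : ℝ) ^ p) ^ m)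
      ≤ ∑' α : Fin n → ℕ, ‖x α‖ₑ ^ p * ((∏ i, r i ^ α i : ℝ≥0) : ℝ≥0∞) ^ p := by
    rw [← sum_multinomial_mul_prod,
      ENNReal.ofReal_sum_of_nonneg fun α _ => by positivity]
    refine le_trans (Finset.sum_le_sum fun α hα => ?_) (ENNReal.sum_le_tsum (multiIndices n m))
    have hxn : ‖x α‖ = Nat.multinomial Finset.univ α := by
      simp only [hx]
      rw [if_pos hα, norm_smul, he, norm_mul, hε]
      simp
    have h1m : (1 : ℝ) ≤ Nat.multinomial Finset.univ α := by
      exact_mod_cast Nat.multinomial_pos Finset.univ α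
    rw [← ofReal_norm, hxn, ← ENNReal.ofReal_coe_nnreal,
      ENNReal.ofReal_rpow_of_nonneg (by positivity) hp0,
      ENNReal.ofReal_rpow_of_nonneg (by positivity) hp0, ← ENNReal.ofReal_mul (by positivity)]
    apply ENNReal.ofReal_le_ofReal
    refine mul_le_mul ?_ (le_of_eq ?_) (by positivity) (by positivity)
    · exact Real.self_le_rpow_of_one_le h1m hp
    · push_cast
      rw [← Real.finsetProd_rpow _ _ fun i _ => by positivity]
      refine Finset.prod_congr rfl fun i _ => ?_
      rw [← Real.rpow_natCast, ← Real.rpow_natCast, ← Real.rpow_mul (by positivity),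
        ← Real.rpow_mul (by positivity), mul_comm]
  have h3 : ENNReal.ofReal lam * Bohr.supNorm Ω f ^ p ≤ ENNReal.ofReal (lam * B ^ p) := by
    rw [ENNReal.ofReal_mul hlam, ← ENNReal.ofReal_rpow_of_nonneg hB0 hp0]
    gcongr
  exact (ENNReal.ofReal_le_ofReal_iff (by positivity)).mp (h2.trans (h1.trans h3))

/-- With this degree `n ≤ e^m`, so the factor `n` is absorbed into an `m`-th power, while `m! ≤ m^m`
contributes `log n` up to a constant. -/
lemma euclideanBound_le_pow {m : ℕ} (hn : 1 < n) (hm : m = ⌈Real.log n⌉₊) :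
    1 ≤ m ∧ euclideanBound n m ≤ (12 * Real.exp 2 * Real.log n) ^ m := by
  have hn' : (2 : ℝ) ≤ n := by exact_mod_cast hn
  have hL2 : (1 / 2 : ℝ) ≤ Real.log n := by
    have := Real.log_two_gt_d9
    have := Real.log_le_log (by norm_num) hn'
    linarith
  have hLm : Real.log n ≤ m := hm ▸ Nat.le_ceil _
  have hmL : (m : ℝ) < Real.log n + 1 := hm ▸ Nat.ceil_lt_add_one (by linarith)
  have hm0 : (0 : ℝ) < m := by linarith
  have hm1 : 1 ≤ m := by exact_mod_cast hm0
  refine ⟨hm1, ?_⟩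
  have h1 : (n : ℝ) ≤ Real.exp 1 ^ m := by
    rw [← Real.exp_nat_mul, mul_one, ← Real.log_le_iff_le_exp (by linarith)]
    exact hLm
  have h2 : (m.factorial : ℝ) ≤ (m : ℝ) ^ m := by exact_mod_cast Nat.factorial_le_pow m
  have h3 : (2 : ℝ) ≤ 2 ^ m := by
    simpa using pow_le_pow_right₀ (by norm_num : (1 : ℝ) ≤ 2) hm1
  have he : Real.exp 2 = Real.exp 1 * Real.exp 1 := by rw [← Real.exp_add]; norm_num
  calc euclideanBound n m ≤ 2 ^ m * Real.exp 1 ^ m * (m : ℝ) ^ m * (2 * Real.exp 1) ^ m := by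
        unfold euclideanBound
        gcongr
    _ = (4 * Real.exp 2 * m) ^ m := by
        rw [← mul_pow, ← mul_pow, ← mul_pow, he]
        congr 1
        ring
    _ ≤ _ := by
        refine pow_le_pow_left₀ (by positivity) ?_ m
        -- From `m < log n + 1` and `log n ≥ 1/2`; this turns the constant 4 into 12.
        have : (m : ℝ) ≤ 3 * Real.log n := by linarith
        nlinarith [Real.exp_pos 2]

/-- Power mean inequality and an `m`-th root. The constants stay uniform in `m` and `a` because `λ ≤
λ^{pm}` and `D^a ≤ D`. It is used with `C` the Euclidean bound, `L = log n`, `a = 1 - 1/min(q,2)`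
and `G = n^{1/2 - 1/max(2,q)}`. -/
lemma mean_le_of_sum_rpow_pow_le {p lam : ℝ} (hp : 1 ≤ p) (hlam : 1 ≤ lam) (hn : 0 < n)
    {r : Fin n → ℝ} (hr : ∀ i, 0 ≤ r i) {m : ℕ} (hm : 1 ≤ m) {a C D L G : ℝ} (ha0 : 0 ≤ a)
    (ha1 : a ≤ 1) (hC0 : 0 ≤ C) (hD : 1 ≤ D) (hL : 0 ≤ L) (hC : C ≤ (D * L) ^ m) (hG : 0 ≤ G)
    (h : (∑ i, r i ^ p) ^ m ≤ lam * (C ^ a * G ^ m) ^ p) :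
    1 / n * ∑ i, r i ≤ lam * D * (L ^ a * G * (n : ℝ) ^ (-(1 / p))) := by
  have hp0 : 0 < p := by linarith
  have hn' : (0 : ℝ) < n := by exact_mod_cast hn
  have hS : 0 ≤ ∑ i, r i := Finset.sum_nonneg fun i _ => hr i
  have hpm : 1 ≤ p * m := by
    have : (1 : ℝ) ≤ m := by exact_mod_cast hm
    nlinarith
  have hm' : m ≠ 0 := by omega
  have h1 : (1 / n * ∑ i, r i) ^ p ≤ (n : ℝ)⁻¹ * ∑ i, r i ^ p := by
    have := Real.rpow_sum_le_const_mul_sum_rpow_of_nonneg Finset.univ hp (f := r) fun i _ => hr i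
    rw [Finset.card_univ, Fintype.card_fin, Real.rpow_sub_one hn'.ne'] at this
    rw [Real.mul_rpow (by positivity) hS, one_div, Real.inv_rpow hn'.le,
      inv_mul_le_iff₀ (by positivity)]
    calc _ ≤ _ := this
      _ = _ := by field_simp
  have h2 : ((1 / n * ∑ i, r i) ^ p) ^ m
      ≤ ((lam * D * (L ^ a * G * (n : ℝ) ^ (-(1 / p)))) ^ p) ^ m := by
    calc ((1 / n * ∑ i, r i) ^ p) ^ m ≤ ((n : ℝ)⁻¹ * ∑ i, r i ^ p) ^ m := by gcongr
      _ ≤ ((n : ℝ)⁻¹) ^ m * (lam * (C ^ a * G ^ m) ^ p) := by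
        rw [mul_pow]; gcongr
      _ ≤ ((n : ℝ)⁻¹) ^ m * ((lam ^ p) ^ m * ((D ^ m * (L ^ a) ^ m) * G ^ m) ^ p) := by
        gcongr
        · rw [← Real.rpow_natCast, ← Real.rpow_mul (by linarith)]
          exact Real.self_le_rpow_of_one_le hlam hpm
        · calc C ^ a ≤ ((D * L) ^ m) ^ a := by gcongr
            _ = (D ^ m) ^ a * (L ^ a) ^ m := by
              rw [mul_pow, Real.mul_rpow (by positivity) (by positivity)]
              congr 1
              rw [← Real.rpow_natCast, ← Real.rpow_natCast, ← Real.rpow_mul hL,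
                ← Real.rpow_mul hL, mul_comm]
            _ ≤ D ^ m * (L ^ a) ^ m := by
              gcongr
              exact (Real.rpow_le_rpow_of_exponent_le (one_le_pow₀ hD) ha1).trans
                (Real.rpow_one _).le
      _ = _ := by
        have hn1 : ((n : ℝ) ^ (-(1 / p))) ^ p = (n : ℝ)⁻¹ := by
          rw [← Real.rpow_mul hn'.le, neg_mul, one_div, inv_mul_cancel₀ hp0.ne', Real.rpow_neg_one]
        have hsw : ((D ^ m * (L ^ a) ^ m) * G ^ m) ^ p = ((D * L ^ a * G) ^ p) ^ m := by
          rw [← mul_pow, ← mul_pow, ← Real.rpow_natCast, ← Real.rpow_natCast,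
            ← Real.rpow_mul (by positivity), ← Real.rpow_mul (by positivity), mul_comm p]
        rw [hsw, ← hn1, ← mul_pow, ← mul_pow, ← Real.mul_rpow (by positivity) (by positivity),
          ← Real.mul_rpow (by positivity) (by positivity)]
        congr 2
        ring
  have h3 := le_of_pow_le_pow_left₀ hm' (by positivity) h2
  exact (Real.rpow_le_rpow_iff (by positivity) (by positivity) hp0).mp h3

lemma arithmeticBohrRadius_lqBall_le [Nontrivial X] {p lam : ℝ} (hp : 1 ≤ p) (hlam : 1 ≤ lam)
    {q : ℝ≥0∞} (hq : 1 ≤ q) (hn : 1 < n) :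
    Bohr.arithmeticBohrRadius X p (Bohr.lqBall n q) lam
      ≤ ENNReal.ofReal (lam * (12 * Real.exp 2) * (Real.log n ^ (1 - (1 / min q 2).toReal) /
          (n : ℝ) ^ (1 / p + (1 / max 2 q).toReal - 1 / 2))) := by
  have hn0 : 0 < n := by omega
  have hn' : (0 : ℝ) < n := by exact_mod_cast hn0
  refine sSup_le ?_
  rintro _ ⟨r, rfl, hr⟩
  rw [← ENNReal.ofReal_coe_nnreal]
  apply ENNReal.ofReal_le_ofReal
  obtain ⟨hm1, hC⟩ := euclideanBound_le_pow hn rfl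
  set m := ⌈Real.log n⌉₊
  obtain ⟨ε, hε, hB⟩ := exists_unimodularPolynomial_norm_le_on_lqBall n m hn0 hq
  have hC0 := euclideanBound_nonneg n m
  have h := sum_rpow_pow_le_of_unimodularPolynomial_le hp (by linarith) hr hε (by positivity) hB
  have ha0 : 0 ≤ 1 - (1 / min q 2).toReal := by
    have h1 : 1 / min q 2 ≤ 1 := by
      rw [one_div]
      exact ENNReal.inv_le_one.mpr (le_min hq (by norm_num))
    have := ENNReal.toReal_mono ENNReal.one_ne_top h1
    rw [ENNReal.toReal_one] at this
    linarith
  have hD : 1 ≤ 12 * Real.exp 2 := by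
    have := Real.one_le_exp (x := 2) (by norm_num)
    linarith
  have key := mean_le_of_sum_rpow_pow_le hp hlam hn0 (fun i => (r i).coe_nonneg) hm1 ha0
    (by linarith [ENNReal.toReal_nonneg (a := 1 / min q 2)]) hC0 hD
    (Real.log_nonneg (by exact_mod_cast hn.le)) hC (by positivity) h
  push_cast
  refine key.trans (le_of_eq ?_)
  rw [mul_assoc (_ ^ _), ← Real.rpow_add hn', div_eq_mul_inv (Real.log n ^ _), ← Real.rpow_neg hn'.le]
  congr 3
  ring

lemma smul_const_mem_lqBall (hn : 0 < n) {q : ℝ≥0∞} (hq : 1 ≤ q) {s : ℝ} (hs0 : 0 ≤ s)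
    (hs1 : s < 1) :
    (fun _ : Fin n => ((s * (n : ℝ) ^ (-(1 / q).toReal) : ℝ) : ℂ)) ∈ Bohr.lqBall n q := by
  have hn' : (0 : ℝ) < n := by exact_mod_cast hn
  have : Fact (1 ≤ q) := ⟨hq⟩
  have : Nonempty (Fin n) := ⟨⟨0, hn⟩⟩
  rw [Bohr.lqBall, Set.mem_ofPred_eq]
  have h := PiLp.norm_toLp_const' (p := q) (ι := Fin n)
    (((s * (n : ℝ) ^ (-(1 / q).toReal) : ℝ) : ℂ))
  refine lt_of_eq_of_lt h ?_
  rw [Complex.norm_real, Real.norm_eq_abs, abs_of_nonneg (by positivity)]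
  simp only [Fintype.card_fin, NNReal.coe_natCast]
  rw [mul_left_comm, ← Real.rpow_add hn']
  simpa using hs1

lemma bohrRadius_div_le_arithmeticBohrRadius {p lam : ℝ} (hp : 0 ≤ p) (hlam : 1 ≤ lam)
    {q : ℝ≥0∞} (hq : 1 ≤ q) (hn : 0 < n) :
    Bohr.bohrRadius X p (Bohr.lqBall n q) 1 / (n : ℝ≥0∞) ^ (1 / q).toReal
      ≤ Bohr.arithmeticBohrRadius X p (Bohr.lqBall n q) lam := by
  have hn' : (n : ℝ≥0) ≠ 0 := by exact_mod_cast hn.ne'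
  have hpow : (n : ℝ≥0∞) ^ (1 / q).toReal = (((n : ℝ≥0) ^ (1 / q).toReal : ℝ≥0) : ℝ≥0∞) := by
    rw [ENNReal.coe_rpow_of_ne_zero hn', ENNReal.coe_natCast]
  have hpos : 0 < (n : ℝ≥0) ^ (1 / q).toReal := NNReal.rpow_pos (pos_iff_ne_zero.mpr hn')
  rw [hpow]
  refine ENNReal.div_le_of_le_mul (sSup_le ?_)
  rintro _ ⟨r, -, rfl, hr⟩
  -- The ball is open, so the constant vector built from `r` itself may fall outside `rΩ`; any `t <
  -- r` works and suffices for the supremum.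
  refine ENNReal.le_of_forall_nnreal_lt fun t ht => ?_
  have htr : t < r := by exact_mod_cast ht
  have hr0 : 0 < r := pos_of_gt htr
  set c : ℝ≥0 := t / (n : ℝ≥0) ^ (1 / q).toReal with hc
  have hct : t = c * (n : ℝ≥0) ^ (1 / q).toReal := (div_mul_cancel₀ _ hpos.ne').symm
  rw [hct, ENNReal.coe_mul]
  gcongr
  refine le_sSup ⟨fun _ => c, ?_, fun f hf x hx => ?_⟩
  · rw [Finset.sum_const, Finset.card_univ, Fintype.card_fin, nsmul_eq_mul, one_div,
      inv_mul_cancel_left₀ hn']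
  · have hz : (fun _ : Fin n => ((c : ℝ) : ℂ)) ∈ ((r : ℝ) : ℂ) • Bohr.lqBall n q := by
      refine ⟨_, smul_const_mem_lqBall hn hq (s := t / r) (by positivity)
        ((div_lt_one (by exact_mod_cast hr0)).mpr (by exact_mod_cast htr)), ?_⟩
      funext i
      simp only [Pi.smul_apply, smul_eq_mul]
      rw [← Complex.ofReal_mul]
      congr 1
      rw [hc, NNReal.coe_div, NNReal.coe_rpow, NNReal.coe_natCast,
        Real.rpow_neg (by positivity)]
      have : (r : ℝ) ≠ 0 := by exact_mod_cast hr0.ne'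
      field_simp
    have h1 := (le_iSup₂ (f := fun (z : Fin n → ℂ) (_ : z ∈ ((r : ℝ) : ℂ) • Bohr.lqBall n q) =>
      ∑' α : Fin n → ℕ, ‖(∏ i, z i ^ α i) • x α‖ₑ ^ p) _ hz).trans (hr f hf.1 x hx)
    calc _ = ∑' α : Fin n → ℕ, ‖(∏ i, ((c : ℝ) : ℂ) ^ α i) • x α‖ₑ ^ p := by
          refine tsum_congr fun α => ?_
          rw [enorm_smul, ENNReal.mul_rpow_of_nonneg _ _ hp, mul_comm]
          congr 2
          rw [← ofReal_norm, norm_prod, ← ENNReal.ofReal_coe_nnreal]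
          simp
      _ ≤ _ := h1
      _ ≤ _ := by gcongr

end ArithmeticBohrRadius

theorem theorem2p2 (p : ℝ) (hp : 1 ≤ p) (lam : ℝ) (hlam : 1 ≤ lam) :
    ∃ d : ℝ, 0 < d ∧
      ∀ (X : Type*) [NormedAddCommGroup X] [NormedSpace ℂ X] [CompleteSpace X] [Nontrivial X]
        (q : ℝ≥0∞) (_ : 1 ≤ q) (n : ℕ) (_ : 1 < n),
        Bohr.bohrRadius X p (Bohr.lqBall n q) 1 / (n : ℝ≥0∞) ^ (1 / q).toReal
            ≤ Bohr.arithmeticBohrRadius X p (Bohr.lqBall n q) lam ∧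
          Bohr.arithmeticBohrRadius X p (Bohr.lqBall n q) lam
            ≤ ENNReal.ofReal (d * (Real.log n ^ (1 - (1 / min q 2).toReal) /
                (n : ℝ) ^ (1 / p + (1 / max 2 q).toReal - 1 / 2))) := by
  refine ⟨lam * (12 * Real.exp 2), by positivity, fun X _ _ _ _ q hq n hn => ⟨?_, ?_⟩⟩
  · exact bohrRadius_div_le_arithmeticBohrRadius (by linarith) hlam hq (by omega)
  · exact arithmeticBohrRadius_lqBall_le hp hlam hq hn
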